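/- Let $(\rho_n)_{n\in\mathbb N}$ be integrable functions on $\mathbb R$ with $\rho_n\ge 0$, $\int_{\mathbb R}\rho_n\,dx=1$ for all $n$, and $\lim_{n\to\infty}\int_{|x|>\gamma}\rho_n(x)\,dx=0$ for every $\gamma>0$. Let $u\in \mathrm{BV}^2(\mathbb R)$, i.e. $u\in W^{1,1}(\mathbb R)$ and the weak derivative $u'$ lies in $\mathrm{BV}(\mathbb R)$, and let $D^2u:=D(u')$ be the finite signed Radon measure on $\mathbb R$ which is the distributional derivative of $u'$. For $n\in\mathbb N$ let $$H_nu(x):=\frac{N(N+2)}{2}\int_{\mathbb R}\frac{u(x+h)-2u(x)+u(x-h)}{|h|^2}\,\frac{h\cdot h-\frac{|h|^2}{N+2}}{|h|^2}\,\rho_n(h)\,dh\quad\text{with }N=1,$$ that is, $H_nu(x)=\int_{\mathbb R}\frac{u(x+h)-2u(x)+u(x-h)}{|h|^2}\rho_n(h)\,dh$. Then, for every $n$, this Lebesgue integral exists for a.e. $x\in\mathbb R$ and $H_nu\in L^1(\mathbb R)$, so that $\mu_n:=H_nu\,\mathcal L^1$ is a finite signed Radon measure; and $\mu_n$ converges to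 $D^2u$ strictly as measures as $n\to\infty$: $$\int_{\mathbb R}\varphi\,d\mu_n\to\int_{\mathbb R}\varphi\,dD^2u\quad\text{for every }\varphi\in C_0(\mathbb R),\qquad\text{and}\qquad |\mu_n|(\mathbb R)\to|D^2u|(\mathbb R),$$ where $C_0(\mathbb R)$ denotes the continuous functions vanishing at infinity and $|\cdot|$ the total variation measure. -/

import Mathlib

open MeasureTheory Filter Topology
open scoped ContDiff

noncomputable section

/-- The sequence of weights `ρₙ` on `ℝ`: nonnegative, of integral one (which makes each `ρₙ`
Lebesgue integrable), and concentrating at the origin. -/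
structure IsWeightSequence (ρ : ℕ → ℝ → ℝ) : Prop where
  nonneg : ∀ n x, 0 ≤ ρ n x
  integrable : ∀ n, Integrable (ρ n)
  integral_eq_one : ∀ n, ∫ x, ρ n x = 1
  tendsto_tail : ∀ γ : ℝ, 0 < γ → Tendsto (fun n => ∫ x in {x : ℝ | γ < |x|}, ρ n x) atTop (𝓝 0)

/-- Real-valued test functions on the line, `φ ∈ C_c^∞(ℝ)`. -/
def IsTestFunction (φ : ℝ → ℝ) : Prop := ContDiff ℝ ∞ φ ∧ HasCompactSupport φ

/-- `g` is the weak derivative of `u`. -/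
def HasWeakDeriv (u g : ℝ → ℝ) : Prop :=
  ∀ φ : ℝ → ℝ, IsTestFunction φ → ∫ x, u x * deriv φ x = -∫ x, g x * φ x

/-- The distributional derivative of `g` is represented by the finite signed Borel measure `m`. -/
def HasDistribDeriv (g : ℝ → ℝ) (m : SignedMeasure ℝ) : Prop :=
  ∀ φ : ℝ → ℝ, IsTestFunction φ → ∫ x, g x * deriv φ x = -∫ᵛ x, φ x ∂•m

/-- `v ∈ BV(ℝ)`: `v ∈ L¹(ℝ)` and `Dv` is a finite signed measure. -/
def MemBV (v : ℝ → ℝ) : Prop := Integrable v ∧ ∃ m : SignedMeasure ℝ, HasDistribDeriv v m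

/-- `u ∈ W^{1,1}(ℝ)` with weak derivative `g`. -/
def HasSobolevDeriv (u g : ℝ → ℝ) : Prop := Integrable u ∧ Integrable g ∧ HasWeakDeriv u g

/-- `u ∈ BV²(ℝ)`: `u ∈ W^{1,1}(ℝ)` and its weak derivative belongs to `BV(ℝ)`. -/
def MemBV2 (u : ℝ → ℝ) : Prop := ∃ g : ℝ → ℝ, HasSobolevDeriv u g ∧ MemBV g

/-- The signed measure `m` is the second derivative `D²u = D(u')` of `u ∈ W^{1,1}(ℝ)`. -/
def IsSecondDeriv (u : ℝ → ℝ) (m : SignedMeasure ℝ) : Prop :=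
  ∃ g : ℝ → ℝ, HasSobolevDeriv u g ∧ HasDistribDeriv g m

/-- The integrand of the nonlocal Hessian in dimension `N = 1`, where `h ⊗ h = h * h` and the
identity matrix is `1`, so that `h ⊗ h - |h|² / (N + 2) I = h * h - |h|² / (1 + 2)`. -/
def nonlocalHessianIntegrand (ρ : ℝ → ℝ) (u : ℝ → ℝ) (x h : ℝ) : ℝ :=
  (u (x + h) - 2 * u x + u (x - h)) / |h| ^ 2 *
    ((h * h - |h| ^ 2 / (1 + 2)) / |h| ^ 2) * ρ h

/-- The nonlocal Hessian in dimension `N = 1`, with its normalizing factor `N (N + 2) / 2`. -/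
def nonlocalHessian (ρ : ℝ → ℝ) (u : ℝ → ℝ) (x : ℝ) : ℝ :=
  (1 * (1 + 2) / 2) * ∫ h, nonlocalHessianIntegrand ρ u x h

/-- Weak-star convergence of finite signed measures on `ℝ`, tested against `C₀(ℝ)`. -/
def TendstoWeakStar (μ : ℕ → SignedMeasure ℝ) (m : SignedMeasure ℝ) : Prop :=
  ∀ φ : ZeroAtInftyContinuousMap ℝ ℝ,
    Tendsto (fun n => ∫ᵛ x, φ x ∂•(μ n)) atTop (𝓝 (∫ᵛ x, φ x ∂•m))

/-- Strict convergence: weak-star convergence and convergence of the total variations. -/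
def TendstoStrictly (μ : ℕ → SignedMeasure ℝ) (m : SignedMeasure ℝ) : Prop :=
  TendstoWeakStar μ m ∧
    Tendsto (fun n => (μ n).totalVariation Set.univ) atTop (𝓝 (m.totalVariation Set.univ))

end

/-! Everything is dual to one identity: the symmetric second difference of a test function `φ` with
step `h` is the second derivative of `tentIntegral h φ`. Pairing `Hₙu` with `φ`, applying Fubini and
moving both derivatives onto `u` gives `∫ ρₙ(h) h⁻² (∫ tentIntegral h φ dD²u) dh`.

For `h ≠ 0`, `h⁻² tentIntegral h φ` is an average of `φ` near each point. So it is bounded by `sup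
|φ|`, which gives integrability of `Hₙu` and `|μₙ|(ℝ) ≤ |D²u|(ℝ)` for every `n`. It also tends to
`φ` uniformly as `h → 0`, which gives convergence against test functions because `ρₙ` concentrates
at the origin (`IsWeightSequence.tendsto_integral_mul`).

The uniform mass bound and density extend this to `C₀(ℝ)`. Testing with a `φ` that nearly attains
`|D²u|(ℝ)` gives the lower bound for the masses, the upper bound being known for each `n`. -/

theorem lsmul_real_flip :
    (ContinuousLinearMap.lsmul ℝ ℝ : ℝ →L[ℝ] ℝ →L[ℝ] ℝ).flip = ContinuousLinearMap.lsmul ℝ ℝ := by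
  ext; simp

/-! ### Integration against signed measures and densities -/

section SignedMeasure

variable {X : Type*} {mX : MeasurableSpace X}

instance isFiniteMeasure_variation (m : SignedMeasure X) : IsFiniteMeasure m.variation := by
  rw [← SignedMeasure.totalVariation_eq_variation, SignedMeasure.totalVariation]
  infer_instance

theorem integral_toSignedMeasure_sub (μ ν : Measure X) [IsFiniteMeasure μ] [IsFiniteMeasure ν]
    {φ : X → ℝ} (hμ : Integrable φ μ) (hν : Integrable φ ν) :
    ∫ᵛ x, φ x ∂•(μ.toSignedMeasure - ν.toSignedMeasure) = ∫ x, φ x ∂μ - ∫ x, φ x ∂ν := by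
  rw [VectorMeasure.integral_sub_vectorMeasure (by simpa [VectorMeasure.Integrable] using hμ)
    (by simpa [VectorMeasure.Integrable] using hν), ← lsmul_real_flip,
    VectorMeasure.integral_toSignedMeasure, VectorMeasure.integral_toSignedMeasure]

theorem integral_signedMeasure_eq_sub (m : SignedMeasure X) {φ : X → ℝ}
    (hp : Integrable φ m.toJordanDecomposition.posPart)
    (hn : Integrable φ m.toJordanDecomposition.negPart) :
    ∫ᵛ x, φ x ∂•m = ∫ x, φ x ∂m.toJordanDecomposition.posPart -
      ∫ x, φ x ∂m.toJordanDecomposition.negPart := by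
  conv_lhs => rw [← SignedMeasure.toSignedMeasure_toJordanDecomposition m]
  exact integral_toSignedMeasure_sub _ _ hp hn

theorem integral_withDensityᵥ (μ : Measure X) {f φ : X → ℝ} (hf : Integrable f μ)
    (hφ : Measurable φ) {C : ℝ} (hC : ∀ x, |φ x| ≤ C) :
    ∫ᵛ x, φ x ∂•(μ.withDensityᵥ f) = ∫ x, f x * φ x ∂μ := by
  have h1 := isFiniteMeasure_withDensity_ofReal hf.2
  have h2 := isFiniteMeasure_withDensity_ofReal hf.neg.2
  have hb (ν : Measure X) [IsFiniteMeasure ν] : Integrable φ ν :=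
    .of_bound hφ.aestronglyMeasurable C (.of_forall hC)
  have hi (g : X → ℝ) (hg : Integrable g μ) : Integrable (fun x => g x * φ x) μ :=
    hg.mul_bdd (c := C) hφ.aestronglyMeasurable (.of_forall hC)
  rw [withDensityᵥ_eq_withDensity_pos_part_sub_withDensity_neg_part hf]
  have hd (g : X → ℝ) (hg : Integrable g μ) :
      ∫ x, φ x ∂(μ.withDensity fun x => ENNReal.ofReal (g x)) = ∫ x, max (g x) 0 * φ x ∂μ := by
    rw [integral_withDensity_eq_integral_toReal_smul₀ hg.aemeasurable.ennreal_ofReal (by simp)]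
    simp [ENNReal.toReal_ofReal']
  rw [integral_toSignedMeasure_sub _ _ (hb _) (hb _), hd f hf, hd (fun x => -f x) hf.neg,
    ← integral_sub (hi _ hf.pos_part) (hi _ hf.neg_part)]
  congr with x
  rw [← sub_mul]
  congr 1
  rcases le_total 0 (f x) with h | h <;> simp [h]

theorem abs_integral_signedMeasure_le (m : SignedMeasure X) {φ : X → ℝ} {C : ℝ}
    (hC : ∀ x, |φ x| ≤ C) : |∫ᵛ x, φ x ∂•m| ≤ C * m.totalVariation.real Set.univ := by
  rw [SignedMeasure.totalVariation_eq_variation]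
  refine (VectorMeasure.norm_integral_le_of_norm_le_const (μ := m)
    (B := ContinuousLinearMap.lsmul ℝ ℝ) (f := φ) (C := C) (.of_forall hC)).trans ?_
  simp

theorem totalVariation_withDensityᵥ_univ (μ : Measure X) {f : X → ℝ} (hf : Integrable f μ) :
    (SignedMeasure.totalVariation (μ.withDensityᵥ f)).real Set.univ = ∫ x, |f x| ∂μ := by
  rw [SignedMeasure.totalVariation_eq_variation, Measure.variation_withDensityᵥ hf, measureReal_def,
    withDensity_apply _ MeasurableSet.univ, Measure.restrict_univ]
  exact (integral_norm_eq_lintegral_enorm hf.1).symm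

end SignedMeasure

/-! ### Test functions: Urysohn functions, duality with total variation, density -/

theorem IsTestFunction.exists_bound {φ : ℝ → ℝ} (h : IsTestFunction φ) : ∃ C, ∀ x, |φ x| ≤ C :=
  h.2.exists_bound_of_continuous h.1.continuous

theorem exists_smooth_zero_one {s t : Set ℝ} (hs : IsClosed s) (ht : IsClosed t)
    (hd : Disjoint s t) : ∃ f : ℝ → ℝ, ContDiff ℝ ∞ f ∧ (∀ x ∈ s, f x = 0) ∧
      (∀ x ∈ t, f x = 1) ∧ ∀ x, f x ∈ Set.Icc 0 1 := by
  obtain ⟨f, h0, h1, h⟩ := exists_contMDiffMap_zero_one_of_isClosed (n := ⊤)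
    (modelWithCornersSelf ℝ ℝ) hs ht hd
  exact ⟨f, f.contMDiff.contDiff, fun x hx => h0 hx, fun x hx => h1 hx, h⟩

/-- Smooth Urysohn function with compact support. -/
theorem exists_testFunction_zero_one {s t : Set ℝ} (hs : IsClosed s) (ht : IsCompact t)
    (hd : Disjoint s t) : ∃ f : ℝ → ℝ, IsTestFunction f ∧ (∀ x ∈ s, f x = 0) ∧
      (∀ x ∈ t, f x = 1) ∧ ∀ x, f x ∈ Set.Icc 0 1 := by
  obtain ⟨R, hR⟩ := ht.isBounded.subset_ball (0 : ℝ)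
  -- Adding the complement of a ball around `t` to the zero set forces compact support.
  obtain ⟨f, hf, h0, h1, h⟩ := exists_smooth_zero_one
    (hs.union (Metric.isOpen_ball (x := (0 : ℝ)) (ε := R)).isClosed_compl) ht.isClosed
    (hd.union_left (Set.disjoint_compl_left_iff_subset.2 hR))
  refine ⟨f, ⟨hf, ?_⟩, fun x hx => h0 x (.inl hx), h1, h⟩
  refine HasCompactSupport.intro (isCompact_closedBall (0 : ℝ) R) fun x hx => h0 x (.inr ?_)
  exact fun h => hx (Metric.ball_subset_closedBall h)

/-- Integrate the pointwise bound `φ ≥ 2 · 1_K - 1`; the factor 2 is the drop from 1 to -1 off `K`.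
-/
theorem integral_ge_of_eq_one_on (μ : Measure ℝ) [IsFiniteMeasure μ] {φ : ℝ → ℝ}
    (hφ : Integrable φ μ) {K : Set ℝ} (hK : MeasurableSet K) (h1 : ∀ x ∈ K, φ x = 1)
    (hb : ∀ x, -1 ≤ φ x) {ε : ℝ} (hε : μ.real Set.univ - ε ≤ μ.real K) :
    μ.real Set.univ - 2 * ε ≤ ∫ x, φ x ∂μ := by
  have h2 : ∫ x, (2 * K.indicator 1 x - 1 : ℝ) ∂μ ≤ ∫ x, φ x ∂μ := by
    refine integral_mono ?_ hφ fun x => ?_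
    · exact (((integrable_const 1).indicator hK).const_mul 2).sub (integrable_const _)
    · by_cases hx : x ∈ K
      · simp [hx, h1]; norm_num
      · simpa [hx] using hb x
  rw [integral_sub (((integrable_const 1).indicator hK).const_mul 2) (integrable_const _),
    integral_const_mul, integral_indicator_one hK] at h2
  simp at h2
  linarith

/-- The total variation of a signed measure is the supremum of its values on test functions
bounded by one. -/
theorem exists_testFunction_integral_ge (m : SignedMeasure ℝ) {ε : ℝ} (hε : 0 < ε) :
    ∃ φ, IsTestFunction φ ∧ (∀ x, |φ x| ≤ 1) ∧
      m.totalVariation.real Set.univ - ε ≤ ∫ᵛ x, φ x ∂•m := by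
  set p := m.toJordanDecomposition.posPart
  set n := m.toJordanDecomposition.negPart
  obtain ⟨S, hS, hpS, hnS⟩ := m.toJordanDecomposition.mutuallySingular
  have key (μ : Measure ℝ) [IsFiniteMeasure μ] (T : Set ℝ) (hT : MeasurableSet T)
      (h0 : μ Tᶜ = 0) : ∃ K ⊆ T, IsCompact K ∧ μ.real Set.univ - ε / 4 ≤ μ.real K := by
    obtain ⟨K, hKT, hK, hlt⟩ := hT.exists_isCompact_lt_add (measure_ne_top μ T)
      (ε := ENNReal.ofReal (ε / 4)) (by simpa using hε)
    refine ⟨K, hKT, hK, ?_⟩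
    have h1 : μ.real Set.univ = μ.real T := by
      rw [← measureReal_add_measureReal_compl hT, measureReal_def μ Tᶜ, h0]; simp
    have h2 := ENNReal.toReal_mono (by finiteness) hlt.le
    rw [ENNReal.toReal_add (by finiteness) (by finiteness),
      ENNReal.toReal_ofReal (by positivity)] at h2
    rw [h1]
    simp only [measureReal_def]
    linarith
  obtain ⟨K, hKS, hK, hKp⟩ := key p Sᶜ hS.compl (by simpa using hpS)
  obtain ⟨K', hKS', hK', hKn⟩ := key n S hS hnS
  have hd : Disjoint K K' := Set.disjoint_of_subset hKS hKS' disjoint_compl_left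
  -- The compacts `K` and `K'` nearly carry the positive and negative parts; `f - f'` is 1 on `K`
  -- and -1 on `K'`.
  obtain ⟨f, hf, hf0, hf1, hfb⟩ := exists_testFunction_zero_one hK'.isClosed hK hd.symm
  obtain ⟨f', hf', hf0', hf1', hfb'⟩ := exists_testFunction_zero_one hK.isClosed hK' hd
  have hbd : ∀ x, |f x - f' x| ≤ 1 := fun x => by
    obtain ⟨h1, h2⟩ := hfb x
    obtain ⟨h3, h4⟩ := hfb' x
    rw [abs_le]; constructor <;> linarith
  have hi (μ : Measure ℝ) [IsFiniteMeasure μ] : Integrable (fun x => f x - f' x) μ :=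
    .of_bound (hf.1.continuous.sub hf'.1.continuous).aestronglyMeasurable 1 (.of_forall hbd)
  refine ⟨fun x => f x - f' x, ⟨hf.1.sub hf'.1, hf.2.sub hf'.2⟩, hbd, ?_⟩
  rw [integral_signedMeasure_eq_sub m (hi _) (hi _)]
  have h1 := integral_ge_of_eq_one_on p (hi p) hK.measurableSet
    (fun x hx => by rw [hf1 x hx, hf0' x hx]; simp) (fun x => (abs_le.1 (hbd x)).1) hKp
  have h2 := integral_ge_of_eq_one_on n (hi n).neg hK'.measurableSet
    (fun x hx => by simp [hf1' x hx, hf0 x hx])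
    (fun x => by have := (abs_le.1 (hbd x)).2; simp only [Pi.neg_apply]; linarith) hKn
  simp only [Pi.neg_apply, integral_neg] at h2
  have h3 : m.totalVariation.real Set.univ = p.real Set.univ + n.real Set.univ := by
    rw [SignedMeasure.totalVariation, measureReal_add_apply]
  linarith

theorem totalVariation_le_of_forall_testFunction (m : SignedMeasure ℝ) {C : ℝ}
    (h : ∀ φ, IsTestFunction φ → (∀ x, |φ x| ≤ 1) → ∫ᵛ x, φ x ∂•m ≤ C) :
    m.totalVariation.real Set.univ ≤ C := by
  refine le_of_forall_pos_le_add fun ε hε => ?_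
  obtain ⟨φ, hφ, hb, hge⟩ := exists_testFunction_integral_ge m hε
  linarith [h φ hφ hb]

/-- Test functions are uniformly dense in `C₀(ℝ)`. -/
theorem exists_testFunction_dist_le (f : ZeroAtInftyContinuousMap ℝ ℝ) {ε : ℝ} (hε : 0 < ε) :
    ∃ φ, IsTestFunction φ ∧ ∀ x, |φ x - f x| ≤ ε := by
  obtain ⟨g, hg, hgf⟩ := (ZeroAtInftyContinuousMap.uniformContinuous f).exists_contDiff_dist_le
    (ε := ε / 3) (by positivity)
  obtain ⟨K, hK, hKf⟩ : ∃ K : Set ℝ, IsCompact K ∧ ∀ x ∉ K, |f x| ≤ ε / 3 := by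
    have := f.zero_at_infty'.eventually (Metric.ball_mem_nhds 0 (ε := ε / 3) (by positivity))
    obtain ⟨K, hK, h⟩ := mem_cocompact.1 this
    refine ⟨K, hK, fun x hx => ?_⟩
    have := h hx
    simp only [Set.mem_ofPred_eq, dist_zero_right, Real.norm_eq_abs] at this
    exact this.le
  obtain ⟨χ, hχ, -, h1, hb⟩ := exists_testFunction_zero_one isClosed_empty hK (by simp)
  refine ⟨fun x => χ x * g x, ⟨hχ.1.mul hg, hχ.2.mul_right⟩, fun x => ?_⟩
  have hx := (hgf x).le
  rw [Real.dist_eq] at hx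
  beta_reduce
  by_cases hxK : x ∈ K
  · rw [h1 x hxK, one_mul]; linarith
  · have h2 : |χ x * (g x - f x)| ≤ ε / 3 := by
      rw [abs_mul, abs_of_nonneg (hb x).1]
      nlinarith [(hb x).1, (hb x).2, abs_nonneg (g x - f x)]
    have h3 : |(χ x - 1) * f x| ≤ ε / 3 := by
      rw [abs_mul, abs_of_nonpos (by linarith [(hb x).2])]
      nlinarith [(hb x).1, (hb x).2, abs_nonneg (f x), hKf x hxK]
    calc |χ x * g x - f x| = |χ x * (g x - f x) + (χ x - 1) * f x| := by ring_nf
      _ ≤ _ := abs_add_le _ _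
      _ ≤ ε := by linarith

/-! ### Sliding and tent integrals -/

/-- The integral of `φ` over the interval from `x` to `x + h`. -/
noncomputable def slidingIntegral (h : ℝ) (φ : ℝ → ℝ) (x : ℝ) : ℝ := ∫ t in x..(x + h), φ t

theorem hasDerivAt_slidingIntegral {φ : ℝ → ℝ} (hφ : Continuous φ) (h x : ℝ) :
    HasDerivAt (slidingIntegral h φ) (φ (x + h) - φ x) x := by
  have h1 (y : ℝ) : HasDerivAt (fun z => ∫ t in (0 : ℝ)..z, φ t) (φ y) y :=
    intervalIntegral.integral_hasDerivAt_right (hφ.intervalIntegrable _ _)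
      hφ.aestronglyMeasurable.stronglyMeasurableAtFilter hφ.continuousAt
  have h2 : slidingIntegral h φ =
      fun z => (∫ t in (0 : ℝ)..(z + h), φ t) - ∫ t in (0 : ℝ)..z, φ t := by
    ext z
    rw [intervalIntegral.integral_interval_sub_left (hφ.intervalIntegrable _ _)
      (hφ.intervalIntegrable _ _)]
    rfl
  rw [h2]
  exact ((h1 (x + h)).comp_add_const x h).sub (h1 x)

theorem IsTestFunction.comp_add_const {φ : ℝ → ℝ} (hφ : IsTestFunction φ) (c : ℝ) :
    IsTestFunction fun x => φ (x + c) :=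
  ⟨hφ.1.comp (contDiff_id.add contDiff_const),
    hφ.2.comp_homeomorph (Homeomorph.addRight c)⟩

theorem IsTestFunction.sub {φ ψ : ℝ → ℝ} (hφ : IsTestFunction φ) (hψ : IsTestFunction ψ) :
    IsTestFunction fun x => φ x - ψ x :=
  ⟨hφ.1.sub hψ.1, hφ.2.sub hψ.2⟩

theorem IsTestFunction.slidingIntegral {φ : ℝ → ℝ} (hφ : IsTestFunction φ) (h : ℝ) :
    IsTestFunction (slidingIntegral h φ) := by
  have hd := hasDerivAt_slidingIntegral hφ.1.continuous h
  constructor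
  · rw [contDiff_infty_iff_deriv]
    refine ⟨fun x => (hd x).differentiableAt, ?_⟩
    rw [funext fun x => (hd x).deriv]
    exact ((hφ.comp_add_const h).sub hφ).1
  · obtain ⟨R, hR⟩ := hφ.2.isCompact.isBounded.subset_closedBall (0 : ℝ)
    refine HasCompactSupport.intro (isCompact_closedBall (0 : ℝ) (R + |h|)) fun x hx => ?_
    refine intervalIntegral.integral_zero_ae (.of_forall fun t ht => ?_)
    by_contra h0
    have h1 := hR (subset_tsupport _ h0)
    simp only [Metric.mem_closedBall, dist_zero_right, Real.norm_eq_abs, not_le] at h1 hx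
    have h2 : |t - x| ≤ |h| := by
      simpa using Set.abs_sub_left_of_mem_uIcc (Set.uIoc_subset_uIcc ht)
    linarith [abs_sub_abs_le_abs_sub x t, abs_sub_comm x t]

theorem abs_slidingIntegral_sub_le {φ : ℝ → ℝ} (hφ : Continuous φ) {h x c ε : ℝ}
    (hε : ∀ t, |t - x| ≤ |h| → |φ t - c| ≤ ε) : |slidingIntegral h φ x - h * c| ≤ |h| * ε := by
  have h1 : slidingIntegral h φ x - h * c = ∫ t in x..(x + h), (φ t - c) := by
    rw [intervalIntegral.integral_sub (hφ.intervalIntegrable _ _)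
      (continuous_const.intervalIntegrable _ _)]
    simp [slidingIntegral]
  rw [h1]
  refine (intervalIntegral.norm_integral_le_of_norm_le_const (C := ε) (f := fun t => φ t - c)
    fun t ht => hε t ?_).trans ?_
  · simpa using Set.abs_sub_left_of_mem_uIcc (Set.uIoc_subset_uIcc ht)
  · simp [mul_comm]

/-- The integral of `φ` against the tent function of width `|h|` and height `|h|` around `x`. -/
noncomputable def tentIntegral (h : ℝ) (φ : ℝ → ℝ) (x : ℝ) : ℝ :=
  slidingIntegral h (slidingIntegral h φ) (x - h)

theorem IsTestFunction.tentIntegral {φ : ℝ → ℝ} (hφ : IsTestFunction φ) (h : ℝ) :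
    IsTestFunction (tentIntegral h φ) :=
  ((hφ.slidingIntegral h).slidingIntegral h).comp_add_const (-h)

theorem deriv_tentIntegral {φ : ℝ → ℝ} (hφ : IsTestFunction φ) (h : ℝ) :
    deriv (tentIntegral h φ) = fun x => slidingIntegral h φ x - slidingIntegral h φ (x - h) := by
  ext x
  have := (hasDerivAt_slidingIntegral (hφ.slidingIntegral h).1.continuous h (x - h)).comp_sub_const
    x h
  simp only [sub_add_cancel] at this
  exact this.deriv

/-- Each sliding integral differentiates to a forward difference; the shift by `-h` centres the
second one. -/
theorem deriv_deriv_tentIntegral {φ : ℝ → ℝ} (hφ : IsTestFunction φ) (h : ℝ) :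
    deriv (deriv (tentIntegral h φ)) = fun x => φ (x + h) - 2 * φ x + φ (x - h) := by
  rw [deriv_tentIntegral hφ]
  ext x
  have h1 := hasDerivAt_slidingIntegral hφ.1.continuous h
  refine ((h1 x).sub ((h1 (x - h)).comp_sub_const x h)).deriv.trans ?_
  simp only [sub_add_cancel]
  ring

theorem isTestFunction_deriv_tentIntegral {φ : ℝ → ℝ} (hφ : IsTestFunction φ) (h : ℝ) :
    IsTestFunction (deriv (tentIntegral h φ)) := by
  rw [deriv_tentIntegral hφ]
  exact (hφ.slidingIntegral h).sub ((hφ.slidingIntegral h).comp_add_const (-h))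

/-- The sliding estimate is applied twice. The radius `3 * |h|` is a crude triangle inequality: two
windows and the shift by `-h`. -/
theorem abs_tentIntegral_sub_le {φ : ℝ → ℝ} (hφ : IsTestFunction φ) {h x c ε : ℝ}
    (hε : ∀ t, |t - x| ≤ 3 * |h| → |φ t - c| ≤ ε) :
    |tentIntegral h φ x - h ^ 2 * c| ≤ h ^ 2 * ε := by
  have := abs_slidingIntegral_sub_le (hφ.slidingIntegral h).1.continuous (h := h) (x := x - h)
    (c := h * c) (ε := |h| * ε) fun t ht =>
      abs_slidingIntegral_sub_le hφ.1.continuous fun s hs => hε s ?_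
  · calc |tentIntegral h φ x - h ^ 2 * c| = |tentIntegral h φ x - h * (h * c)| := by ring_nf
      _ ≤ |h| * (|h| * ε) := this
      _ = h ^ 2 * ε := by rw [← sq_abs]; ring
  · have h1 : s - x = (s - t) + (t - (x - h)) + -h := by ring
    have h2 := abs_add_three (s - t) (t - (x - h)) (-h)
    rw [abs_neg, ← h1] at h2
    linarith

theorem abs_tentIntegral_le {φ : ℝ → ℝ} (hφ : IsTestFunction φ) {C : ℝ}
    (hC : ∀ x, |φ x| ≤ C) (h x : ℝ) : |tentIntegral h φ x| ≤ h ^ 2 * C := by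
  simpa using abs_tentIntegral_sub_le hφ (h := h) (x := x) (c := 0) (ε := C)
    fun t _ => by simpa using hC t

/-! ### Second differences of `u` -/

/-- The symmetric second difference of `u` with step `h`. -/
def secondDifference (h : ℝ) (u : ℝ → ℝ) (x : ℝ) : ℝ := u (x + h) - 2 * u x + u (x - h)

theorem integrable_secondDifference {u : ℝ → ℝ} (hu : Integrable u) (h : ℝ) :
    Integrable (secondDifference h u) :=
  ((hu.comp_add_right h).sub (hu.const_mul 2)).add (hu.comp_sub_right h)

theorem integral_secondDifference_mul {u φ : ℝ → ℝ} (hu : Integrable u) (hφ : IsTestFunction φ)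
    (h : ℝ) : ∫ x, secondDifference h u x * φ x = ∫ x, u x * secondDifference h φ x := by
  obtain ⟨C, hC⟩ := hφ.exists_bound
  have hi (f : ℝ → ℝ) (hf : Integrable f) (c : ℝ) : Integrable fun x => f x * φ (x + c) :=
    hf.mul_bdd (c := C) (hφ.comp_add_const c).1.continuous.aestronglyMeasurable
      (.of_forall fun x => hC _)
  have e1 : ∫ x, u (x + h) * φ x = ∫ x, u x * φ (x - h) := by
    rw [← integral_add_right_eq_self (fun x => u x * φ (x - h)) h]; simp
  have e2 : ∫ x, u (x - h) * φ x = ∫ x, u x * φ (x + h) := by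
    rw [← integral_sub_right_eq_self (fun x => u x * φ (x + h)) h]; simp
  have i0 : Integrable fun x => u x * φ x := by simpa using hi u hu 0
  have i1 : Integrable fun x => u (x + h) * φ x := by
    simpa using hi _ (hu.comp_add_right h) 0
  have i2 : Integrable fun x => u (x - h) * φ x := by
    simpa using hi _ (hu.comp_sub_right h) 0
  have i3 : Integrable fun x => u x * φ (x + h) := hi u hu h
  have i4 : Integrable fun x => u x * φ (x - h) := hi u hu (-h)
  have expand (a b c : ℝ → ℝ) (ha : Integrable a) (hb : Integrable b) (hc : Integrable c) :
      ∫ x, (a x - 2 * b x + c x) = (∫ x, a x) - 2 * (∫ x, b x) + ∫ x, c x := by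
    rw [← integral_const_mul, ← integral_sub ha (hb.const_mul 2)]
    exact integral_add (ha.sub (hb.const_mul 2)) hc
  calc ∫ x, secondDifference h u x * φ x
      = ∫ x, (u (x + h) * φ x - 2 * (u x * φ x) + u (x - h) * φ x) := by
        congr with x; simp only [secondDifference]; ring
    _ = ∫ x, (u x * φ (x + h) - 2 * (u x * φ x) + u x * φ (x - h)) := by
        rw [expand _ _ _ i1 i0 i2, expand _ _ _ i3 i0 i4, e1, e2]
        ring
    _ = _ := by congr with x; simp only [secondDifference]; ring

theorem IsSecondDeriv.integrable {u : ℝ → ℝ} {m : SignedMeasure ℝ} (hm : IsSecondDeriv u m) :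
    Integrable u := hm.choose_spec.1.1

/-- The difference moves to `φ` by translation invariance, where it is a second derivative; two
integrations by parts then cancel their signs. -/
theorem IsSecondDeriv.integral_secondDifference_mul {u : ℝ → ℝ} {m : SignedMeasure ℝ}
    (hm : IsSecondDeriv u m) {φ : ℝ → ℝ} (hφ : IsTestFunction φ) (h : ℝ) :
    ∫ x, secondDifference h u x * φ x = ∫ᵛ x, tentIntegral h φ x ∂•m := by
  obtain ⟨g, ⟨hu, -, hug⟩, hgm⟩ := hm
  have h1 := hug _ (isTestFunction_deriv_tentIntegral hφ h)
  rw [hgm _ (hφ.tentIntegral h), neg_neg, deriv_deriv_tentIntegral hφ] at h1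
  rw [_root_.integral_secondDifference_mul hu hφ, ← h1]
  rfl

/-- By duality: the `L¹` norm is the total variation of the density, and tent integrals of `|φ| ≤ 1`
are at most `h ^ 2`. This power cancels the singular kernel. -/
theorem IsSecondDeriv.integral_abs_secondDifference_le {u : ℝ → ℝ} {m : SignedMeasure ℝ}
    (hm : IsSecondDeriv u m) (h : ℝ) :
    ∫ x, |secondDifference h u x| ≤ h ^ 2 * m.totalVariation.real Set.univ := by
  have hi := integrable_secondDifference hm.integrable h
  rw [← totalVariation_withDensityᵥ_univ _ hi]
  refine totalVariation_le_of_forall_testFunction _ fun φ hφ hb => ?_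
  rw [integral_withDensityᵥ _ hi hφ.1.continuous.measurable hb,
    hm.integral_secondDifference_mul hφ]
  refine (le_abs_self _).trans (abs_integral_signedMeasure_le m fun x => ?_)
  simpa using abs_tentIntegral_le hφ hb h x

/-! ### The nonlocal Hessian: integrability, pairing and mass bound -/

theorem nonlocalHessianIntegrand_eq (ρ u : ℝ → ℝ) (x h : ℝ) :
    nonlocalHessianIntegrand ρ u x h =
      2 / 3 * (ρ h * (h ^ 2)⁻¹ * secondDifference h u x) := by
  rw [nonlocalHessianIntegrand, secondDifference, sq_abs]
  rcases eq_or_ne h 0 with rfl | hh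
  · simp
  · field_simp
    ring

theorem aestronglyMeasurable_nonlocalHessianIntegrand {ρ u : ℝ → ℝ} (hρ : Integrable ρ)
    (hu : Integrable u) : AEStronglyMeasurable
      (fun p : ℝ × ℝ => nonlocalHessianIntegrand ρ u p.1 p.2) (volume.prod volume) := by
  have h1 : AEStronglyMeasurable (fun p : ℝ × ℝ => u (p.1 + p.2)) (volume.prod volume) :=
    hu.1.comp_quasiMeasurePreserving
      (Measure.quasiMeasurePreserving_snd.comp
        (measurePreserving_prod_add volume volume).quasiMeasurePreserving)
  have h2 : AEStronglyMeasurable (fun p : ℝ × ℝ => u (p.1 - p.2)) (volume.prod volume) :=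
    hu.1.comp_quasiMeasurePreserving (quasiMeasurePreserving_sub volume volume)
  have h3 : AEStronglyMeasurable (fun p : ℝ × ℝ => u p.1) (volume.prod volume) := hu.1.comp_fst
  have h4 : AEStronglyMeasurable (fun p : ℝ × ℝ => ρ p.2) (volume.prod volume) := hρ.1.comp_snd
  have h5 : AEStronglyMeasurable (fun p : ℝ × ℝ => (p.2 ^ 2)⁻¹) (volume.prod volume) :=
    (measurable_snd.pow_const 2).inv.aestronglyMeasurable
  simp only [nonlocalHessianIntegrand_eq]
  exact ((h4.mul h5).mul ((h1.sub (h3.const_mul 2)).add h2)).const_mul (2 / 3)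

section

variable {ρ u : ℝ → ℝ} {m : SignedMeasure ℝ}

/-- Integrating in `x` first leaves at most `ρ h` times the total variation of `m`, which is
integrable in `h`. -/
theorem IsSecondDeriv.integrable_prod_nonlocalHessianIntegrand (hm : IsSecondDeriv u m)
    (hρ : Integrable ρ) (hρ0 : ∀ x, 0 ≤ ρ x) :
    Integrable (fun p : ℝ × ℝ => nonlocalHessianIntegrand ρ u p.1 p.2) (volume.prod volume) := by
  have hmeas := aestronglyMeasurable_nonlocalHessianIntegrand hρ hm.integrable
  rw [integrable_prod_iff' hmeas]
  constructor
  · refine .of_forall fun h => ?_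
    simp only [nonlocalHessianIntegrand_eq]
    exact ((integrable_secondDifference hm.integrable h).const_mul _).const_mul _
  · refine (hρ.mul_const (m.totalVariation.real Set.univ)).mono'
      hmeas.norm.prod_swap.integral_prod_right' (.of_forall fun h => ?_)
    rw [Real.norm_of_nonneg (integral_nonneg fun _ => norm_nonneg _)]
    simp only [nonlocalHessianIntegrand_eq, Real.norm_eq_abs, abs_mul, integral_const_mul,
      abs_of_nonneg (hρ0 h), abs_inv, abs_pow, sq_abs]
    have h1 := hm.integral_abs_secondDifference_le h
    have h2 : (h ^ 2)⁻¹ * ∫ x, |secondDifference h u x| ≤ m.totalVariation.real Set.univ := by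
      rcases eq_or_ne h 0 with rfl | hh
      · simp
      · rw [inv_mul_le_iff₀ (by positivity)]; exact h1
    have h3 : 0 ≤ (h ^ 2)⁻¹ * ∫ x, |secondDifference h u x| :=
      mul_nonneg (by positivity) (integral_nonneg fun _ => abs_nonneg _)
    have h4 := mul_le_mul_of_nonneg_left h2 (hρ0 h)
    have h5 := mul_nonneg (hρ0 h) h3
    rw [abs_of_pos (by norm_num : (0 : ℝ) < 2 / 3), mul_assoc (ρ h)]
    linarith

theorem IsSecondDeriv.ae_integrable_nonlocalHessianIntegrand (hm : IsSecondDeriv u m)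
    (hρ : Integrable ρ) (hρ0 : ∀ x, 0 ≤ ρ x) :
    ∀ᵐ x : ℝ, Integrable (nonlocalHessianIntegrand ρ u x) :=
  (hm.integrable_prod_nonlocalHessianIntegrand hρ hρ0).prod_right_ae

theorem IsSecondDeriv.integrable_nonlocalHessian (hm : IsSecondDeriv u m)
    (hρ : Integrable ρ) (hρ0 : ∀ x, 0 ≤ ρ x) : Integrable (nonlocalHessian ρ u) :=
  (hm.integrable_prod_nonlocalHessianIntegrand hρ hρ0).integral_prod_left.const_mul _

/-- The pairing of the nonlocal Hessian with a test function, expressed through the second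
derivative measure. -/
theorem IsSecondDeriv.integral_nonlocalHessian (hm : IsSecondDeriv u m)
    (hρ : Integrable ρ) (hρ0 : ∀ x, 0 ≤ ρ x) {φ : ℝ → ℝ} (hφ : IsTestFunction φ) :
    Integrable (fun h => ρ h * ((h ^ 2)⁻¹ * ∫ᵛ x, tentIntegral h φ x ∂•m)) ∧
    ∫ᵛ x, φ x ∂•(volume.withDensityᵥ (nonlocalHessian ρ u)) =
      ∫ h, ρ h * ((h ^ 2)⁻¹ * ∫ᵛ x, tentIntegral h φ x ∂•m) := by
  obtain ⟨C, hC⟩ := hφ.exists_bound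
  have hi : Integrable (fun p : ℝ × ℝ =>
      1 * (1 + 2) / 2 * nonlocalHessianIntegrand ρ u p.1 p.2 * φ p.1) (volume.prod volume) :=
    ((hm.integrable_prod_nonlocalHessianIntegrand hρ hρ0).const_mul _).mul_bdd (c := C)
      (hφ.1.continuous.comp continuous_fst).aestronglyMeasurable (.of_forall fun p => hC p.1)
  have hin (h : ℝ) : ∫ x, 1 * (1 + 2) / 2 * nonlocalHessianIntegrand ρ u x h * φ x =
      ρ h * ((h ^ 2)⁻¹ * ∫ᵛ x, tentIntegral h φ x ∂•m) := by
    rw [← hm.integral_secondDifference_mul hφ, ← integral_const_mul, ← integral_const_mul]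
    congr with x
    rw [nonlocalHessianIntegrand_eq]
    ring
  constructor
  · simpa only [hin] using hi.integral_prod_right
  · rw [integral_withDensityᵥ _ (hm.integrable_nonlocalHessian hρ hρ0)
      hφ.1.continuous.measurable hC]
    simp only [← hin]
    rw [← integral_integral_swap hi]
    simp only [nonlocalHessian, integral_mul_const, integral_const_mul]

theorem abs_inv_sq_mul_integral_tentIntegral_le (m : SignedMeasure ℝ) {φ : ℝ → ℝ}
    (hφ : IsTestFunction φ) {C : ℝ} (hC : ∀ x, |φ x| ≤ C) (h : ℝ) :
    |(h ^ 2)⁻¹ * ∫ᵛ x, tentIntegral h φ x ∂•m| ≤ C * m.totalVariation.real Set.univ := by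
  have hC0 : 0 ≤ C := (abs_nonneg _).trans (hC 0)
  rcases eq_or_ne h 0 with rfl | hh
  · simpa using by positivity
  · rw [abs_mul, abs_inv, abs_pow, sq_abs, inv_mul_le_iff₀ (by positivity), ← mul_assoc]
    exact abs_integral_signedMeasure_le m (abs_tentIntegral_le hφ hC h)

theorem IsSecondDeriv.totalVariation_nonlocalHessian_le (hm : IsSecondDeriv u m)
    (hρ : Integrable ρ) (hρ0 : ∀ x, 0 ≤ ρ x) (hρ1 : ∫ x, ρ x = 1) :
    (SignedMeasure.totalVariation (volume.withDensityᵥ (nonlocalHessian ρ u))).real Set.univ ≤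
      m.totalVariation.real Set.univ := by
  refine totalVariation_le_of_forall_testFunction _ fun φ hφ hb => ?_
  obtain ⟨hi, he⟩ := hm.integral_nonlocalHessian hρ hρ0 hφ
  rw [he, ← one_mul (m.totalVariation.real Set.univ), ← hρ1, ← integral_mul_const]
  refine integral_mono hi (hρ.mul_const _) fun h => ?_
  refine mul_le_mul_of_nonneg_left ((le_abs_self _).trans ?_) (hρ0 h)
  simpa using abs_inv_sq_mul_integral_tentIntegral_le m hφ hb h

end

/-! ### Passage to the limit -/

theorem integrable_signedMeasure_of_bound {X : Type*} {mX : MeasurableSpace X}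
    (m : SignedMeasure X) {φ : X → ℝ} (hφ : Measurable φ) {C : ℝ} (hC : ∀ x, |φ x| ≤ C) :
    m.Integrable φ :=
  Integrable.of_bound hφ.aestronglyMeasurable C (.of_forall hC)

theorem abs_inv_sq_mul_integral_tentIntegral_sub_le (m : SignedMeasure ℝ) {φ : ℝ → ℝ}
    (hφ : IsTestFunction φ) {h ε : ℝ} (hh : h ≠ 0)
    (hε : ∀ x t, |t - x| ≤ 3 * |h| → |φ t - φ x| ≤ ε) :
    |(h ^ 2)⁻¹ * (∫ᵛ x, tentIntegral h φ x ∂•m) - ∫ᵛ x, φ x ∂•m| ≤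
      ε * m.totalVariation.real Set.univ := by
  have hint (ψ : ℝ → ℝ) (hψ : IsTestFunction ψ) : m.Integrable ψ :=
    integrable_signedMeasure_of_bound m hψ.1.continuous.measurable hψ.exists_bound.choose_spec
  have h1 : (h ^ 2)⁻¹ * (∫ᵛ x, tentIntegral h φ x ∂•m) - ∫ᵛ x, φ x ∂•m =
      (h ^ 2)⁻¹ * ∫ᵛ x, (tentIntegral h φ x - h ^ 2 * φ x) ∂•m := by
    have h2 := VectorMeasure.integral_fun_smul (μ := m) (B := ContinuousLinearMap.lsmul ℝ ℝ)
      (h ^ 2) φ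
    simp only [smul_eq_mul] at h2
    rw [VectorMeasure.integral_fun_sub (hint _ (hφ.tentIntegral h))
        (show m.Integrable fun x => h ^ 2 * φ x from (hint φ hφ).smul (h ^ 2)),
      h2, mul_sub, inv_mul_cancel_left₀ (by positivity)]
  rw [h1, abs_mul, abs_inv, abs_pow, sq_abs, inv_mul_le_iff₀ (by positivity), ← mul_assoc]
  exact abs_integral_signedMeasure_le m fun x => abs_tentIntegral_sub_le hφ (hε x)

/-- Averages against a concentrating sequence of weights of a bounded function that is continuous
at the origin, apart from its value there, converge. -/
theorem IsWeightSequence.tendsto_integral_mul {ρ : ℕ → ℝ → ℝ} (hρ : IsWeightSequence ρ)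
    {J : ℝ → ℝ} {c B : ℝ} (hJi : ∀ n, Integrable fun h => ρ n h * J h)
    (hB : ∀ h, h ≠ 0 → |J h - c| ≤ B) (hJ : Tendsto J (𝓝[≠] 0) (𝓝 c)) :
    Tendsto (fun n => ∫ h, ρ n h * J h) atTop (𝓝 c) := by
  have hB0 : 0 ≤ B := (abs_nonneg _).trans (hB 1 one_ne_zero)
  rw [Metric.tendsto_atTop']
  intro ε hε
  obtain ⟨γ, hγ, hγJ⟩ := Metric.mem_nhdsWithin_iff.1
    (hJ.eventually (Metric.closedBall_mem_nhds c (half_pos hε)))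
  -- With the cut at `γ / 2`, the closed region `|h| ≤ γ / 2` lies inside the open ball of radius
  -- `γ`.
  have ht := ((hρ.tendsto_tail (γ / 2) (half_pos hγ)).const_mul B).eventually_lt_const
    (u := ε / 2) (by simpa using hε)
  obtain ⟨N, hN⟩ := eventually_atTop.1 ht
  refine ⟨N, fun n hn => ?_⟩
  have hS : MeasurableSet {x : ℝ | γ / 2 < |x|} := measurableSet_lt measurable_const (by fun_prop)
  have h1 : (∫ h, ρ n h * J h) - c = ∫ h, ρ n h * (J h - c) := by
    simp only [mul_sub]
    rw [integral_sub (hJi n) ((hρ.integrable n).mul_const c), integral_mul_const,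
      hρ.integral_eq_one, one_mul]
  have hi := ((hρ.integrable n).indicator hS).const_mul B
  have h2 : |∫ h, ρ n h * (J h - c)| ≤
      ∫ h, (ρ n h * (ε / 2) + B * {x : ℝ | γ / 2 < |x|}.indicator (ρ n) h) := by
    refine norm_integral_le_of_norm_le (f := fun h => ρ n h * (J h - c))
      (((hρ.integrable n).mul_const _).add hi) ?_
    filter_upwards [Measure.ae_ne volume (0 : ℝ)] with h hh
    rw [norm_mul, Real.norm_of_nonneg (hρ.nonneg n h), Real.norm_eq_abs]
    by_cases hx : γ / 2 < |h|
    · rw [Set.indicator_of_mem (by exact hx)]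
      nlinarith [hρ.nonneg n h, hB h hh, mul_nonneg (hρ.nonneg n h) hε.le,
        mul_le_mul_of_nonneg_left (hB h hh) (hρ.nonneg n h)]
    · rw [Set.indicator_of_notMem (by exact hx), mul_zero, add_zero]
      refine mul_le_mul_of_nonneg_left ?_ (hρ.nonneg n h)
      have := hγJ (a := h) ⟨by simp; linarith, hh⟩
      exact this
  rw [integral_add ((hρ.integrable n).mul_const _) hi, integral_mul_const, integral_const_mul,
    integral_indicator hS, hρ.integral_eq_one, one_mul] at h2
  rw [Real.dist_eq, h1]
  linarith [hN n hn.le]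

section

variable {ρ : ℕ → ℝ → ℝ} {u : ℝ → ℝ} {m : SignedMeasure ℝ}

theorem IsSecondDeriv.tendsto_integral_testFunction (hm : IsSecondDeriv u m)
    (hρ : IsWeightSequence ρ) {φ : ℝ → ℝ} (hφ : IsTestFunction φ) :
    Tendsto (fun n => ∫ᵛ x, φ x ∂•(volume.withDensityᵥ (nonlocalHessian (ρ n) u))) atTop
      (𝓝 (∫ᵛ x, φ x ∂•m)) := by
  obtain ⟨C, hC⟩ := hφ.exists_bound
  have hp (n : ℕ) := hm.integral_nonlocalHessian (hρ.integrable n) (hρ.nonneg n) hφ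
  simp only [fun n => (hp n).2]
  refine hρ.tendsto_integral_mul (B := 2 * C * m.totalVariation.real Set.univ)
    (fun n => (hp n).1) (fun h hh => ?_) ?_
  · refine abs_inv_sq_mul_integral_tentIntegral_sub_le m hφ hh fun x t _ => ?_
    linarith [abs_sub (φ t) (φ x), hC t, hC x]
  · have huc := hφ.2.uniformContinuous_of_continuous hφ.1.continuous
    rw [Metric.tendsto_nhdsWithin_nhds]
    intro ε hε
    set M := m.totalVariation.real Set.univ
    have hM : 0 ≤ M := measureReal_nonneg
    obtain ⟨δ, hδ, hδφ⟩ := Metric.uniformContinuous_iff.1 huc (ε / (M + 1)) (by positivity)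
    refine ⟨δ / 3, by positivity, fun h hh hhδ => ?_⟩
    rw [dist_zero_right, Real.norm_eq_abs] at hhδ
    rw [Real.dist_eq]
    refine (abs_inv_sq_mul_integral_tentIntegral_sub_le m hφ hh fun x t hxt =>
      (hδφ (a := t) (b := x) (by rw [Real.dist_eq]; linarith)).le).trans_lt ?_
    rw [div_mul_eq_mul_div, div_lt_iff₀ (by positivity)]
    linarith

theorem IsSecondDeriv.tendstoWeakStar_nonlocalHessian (hm : IsSecondDeriv u m)
    (hρ : IsWeightSequence ρ) :
    TendstoWeakStar (fun n => volume.withDensityᵥ (nonlocalHessian (ρ n) u)) m := by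
  intro f
  rw [Metric.tendsto_atTop']
  intro ε hε
  set M := m.totalVariation.real Set.univ
  have hM : 0 ≤ M := measureReal_nonneg
  -- `M` bounds the mass of the limit and of every `μₙ`; `M + 1` keeps the denominator positive when
  -- `M = 0`.
  obtain ⟨φ, hφ, hφf⟩ := exists_testFunction_dist_le f (ε := ε / (3 * (M + 1))) (by positivity)
  have hsub (μ : SignedMeasure ℝ) (hμ : μ.totalVariation.real Set.univ ≤ M) :
      |(∫ᵛ x, φ x ∂•μ) - ∫ᵛ x, f x ∂•μ| ≤ ε / 3 := by
    rw [← VectorMeasure.integral_fun_sub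
      (integrable_signedMeasure_of_bound μ hφ.1.continuous.measurable hφ.exists_bound.choose_spec)
      (show μ.Integrable f from integrable_signedMeasure_of_bound μ f.continuous.measurable
        f.toBCF.norm_coe_le_norm)]
    refine (abs_integral_signedMeasure_le μ hφf).trans ?_
    calc ε / (3 * (M + 1)) * μ.totalVariation.real Set.univ ≤ ε / (3 * (M + 1)) * (M + 1) := by
          gcongr; linarith
      _ = ε / 3 := by field_simp
  obtain ⟨N, hN⟩ := Metric.tendsto_atTop'.1 (hm.tendsto_integral_testFunction hρ hφ) (ε / 3)
    (by positivity)
  refine ⟨N, fun n hn => ?_⟩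
  have h1 := hN n hn
  have h2 := hsub _ (hm.totalVariation_nonlocalHessian_le (hρ.integrable n) (hρ.nonneg n)
    (hρ.integral_eq_one n))
  have h3 := hsub m le_rfl
  rw [Real.dist_eq, abs_lt] at *
  rw [abs_le] at h2 h3
  constructor <;> linarith

theorem IsSecondDeriv.tendsto_totalVariation_nonlocalHessian (hm : IsSecondDeriv u m)
    (hρ : IsWeightSequence ρ) :
    Tendsto (fun n => SignedMeasure.totalVariation
      (volume.withDensityᵥ (nonlocalHessian (ρ n) u)) Set.univ) atTop
      (𝓝 (m.totalVariation Set.univ)) := by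
  have hfin (μ : SignedMeasure ℝ) : μ.totalVariation Set.univ ≠ ⊤ := by
    rw [SignedMeasure.totalVariation_eq_variation]; finiteness
  rw [← ENNReal.tendsto_toReal_iff (fun _ => hfin _) (hfin _), Metric.tendsto_atTop']
  intro ε hε
  -- This single `φ` bounds the masses from below for large `n`.
  obtain ⟨φ, hφ, hb, hge⟩ := exists_testFunction_integral_ge m (half_pos hε)
  obtain ⟨N, hN⟩ := Metric.tendsto_atTop'.1 (hm.tendsto_integral_testFunction hρ hφ) (ε / 2)
    (by positivity)
  refine ⟨N, fun n hn => ?_⟩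
  have h1 := hN n hn
  have h2 := hm.totalVariation_nonlocalHessian_le (hρ.integrable n) (hρ.nonneg n)
    (hρ.integral_eq_one n)
  have h3 := (le_abs_self _).trans (abs_integral_signedMeasure_le
    (volume.withDensityᵥ (nonlocalHessian (ρ n) u)) hb)
  rw [Real.dist_eq, abs_lt] at *
  simp only [measureReal_def] at h2 h3 hge
  constructor <;> linarith

end

/-- For `u ∈ BV²(ℝ)` the nonlocal Hessians are well-defined Lebesgue integrals belonging to
`L¹(ℝ)`, and the measures `μₙ = Hₙu 𝓛¹` converge strictly to `D²u`. -/
theorem theorem3p5 (ρ : ℕ → ℝ → ℝ) (hρ : IsWeightSequence ρ) (u : ℝ → ℝ) (hu : MemBV2 u)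
    (D2u : SignedMeasure ℝ) (hD2u : IsSecondDeriv u D2u) :
    (∀ n, ∀ᵐ x : ℝ, Integrable (nonlocalHessianIntegrand (ρ n) u x)) ∧
      (∀ n, Integrable (nonlocalHessian (ρ n) u)) ∧
      TendstoStrictly
        (fun n => (volume : Measure ℝ).withDensityᵥ (nonlocalHessian (ρ n) u)) D2u :=
  ⟨fun n => hD2u.ae_integrable_nonlocalHessianIntegrand (hρ.integrable n) (hρ.nonneg n),
    fun n => hD2u.integrable_nonlocalHessian (hρ.integrable n) (hρ.nonneg n),
    hD2u.tendstoWeakStar_nonlocalHessian hρ, hD2u.tendsto_totalVariation_nonlocalHessian hρ⟩
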